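/- Call a group $G$ an ANC group if $G$ is finite and nilpotent and every abelian normal subgroup of $G$ is cyclic. A linear group over a field $K$ is a subgroup $\Gamma \leqslant \mathrm{GL}(V)$ for a $K$-vector space $V$; it is irreducible if $V \neq 0$ and the only $\Gamma$-invariant subspaces of $V$ are $0$ and $V$. Linear groups $\Gamma \leqslant \mathrm{GL}(V)$ and $\Delta \leqslant \mathrm{GL}(W)$ over $K$ are similar if there is a $K$-isomorphism $\theta\colon V \to W$ with $\theta\,\Gamma\,\theta^{-1} = \Delta$ (for $V = W = K^d$ this is conjugacy of subgroups of $\mathrm{GL}_d(K)$). Theorem 3.1. Let $G$ be an ANC group and let $K$ be a field of characteristic zero. There exist an integer $d$ and an irreducible linear group $G(K) \leqslant \mathrm{GL}(K^d)$ with $G(K) \cong G$. Moreover, $G(K)$ is unique up to similarity: every irreducible linear group over $K$, on any $K$-vector space, that is isomorphic to $G$ as an abstract group is similar to $G(K)$. In contrast, $G$ may have inequivalent faithful irreducible representations over $K$: there are an ANC group $G$ and a field $K$ of characteristic zero such that $G$ has two inequivalent faithful irreducible $K$-representations. -/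

import Mathlib

/-- A group is an `ANC` group if it is finite and nilpotent, and all its
abelian normal subgroups are cyclic. -/
def IsANCGroup (G : Type*) [Group G] : Prop :=
  Finite G ∧ Group.IsNilpotent G ∧
    ∀ A : Subgroup G, A.Normal → IsMulCommutative A → IsCyclic A

/-- The natural action on `V` of a linear group `Γ ≤ GL(V)` over `K`. -/
def naturalRepresentation {K V : Type*} [Field K] [AddCommGroup V] [Module K V]
    (Γ : Subgroup (LinearMap.GeneralLinearGroup K V)) : Representation K Γ V :=
  (Units.coeHom (Module.End K V)).comp Γ.subtype

/-- A linear group `Γ ≤ GL(V)` over `K` is irreducible if `V ≠ 0` and `V` has no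
`Γ`-invariant `K`-subspace besides `0` and `V`. -/
def IsIrreducibleLinearGroup {K V : Type*} [Field K] [AddCommGroup V] [Module K V]
    (Γ : Subgroup (LinearMap.GeneralLinearGroup K V)) : Prop :=
  (naturalRepresentation Γ).IsIrreducible

/-- Linear groups `Γ ≤ GL(V)` and `Δ ≤ GL(W)` over `K` are similar if some `K`-isomorphism
`θ : V → W` carries `Γ` to `Δ`, that is, `Δ = {θ ∘ γ ∘ θ⁻¹ | γ ∈ Γ}`. -/
def AreSimilarLinearGroups {K V W : Type*} [Field K] [AddCommGroup V] [Module K V]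
    [AddCommGroup W] [Module K W]
    (Γ : Subgroup (LinearMap.GeneralLinearGroup K V))
    (Δ : Subgroup (LinearMap.GeneralLinearGroup K W)) : Prop :=
  ∃ θ : V ≃ₗ[K] W,
    Γ.map (LinearMap.GeneralLinearGroup.congrLinearEquiv θ).toMonoidHom = Δ

/-!
The group theory needed is that an ANC group `G` has a cyclic normal subgroup `⟨a⟩` which is its own
centralizer and has index at most two. A maximal abelian normal subgroup of a nilpotent group is its
own centralizer, and here it is cyclic. If its index were greater than two, some `g ∉ ⟨a⟩` with
`g ^ p ∈ ⟨a⟩`, `p` prime, would act on `⟨a⟩` by a power map `a ↦ a ^ r` with `r ≡ 1` modulo every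
prime divisor of `n = orderOf a`, and modulo `4` if `n` is even. Then the coset of `g` contains an
element of order `p`, and the elements of order dividing `p` in `⟨a, g⟩` include a noncyclic abelian
normal subgroup of `G` (`IsANCGroup.mem_zpowers_of_pow_prime_mem`, `IsANCGroup.mul_mem_zpowers`).
Since the index is at most two, `a ↦ a ^ k` extends to an automorphism of `G` for each odd `k`
prime to `n` (`exists_mulEquiv_eq_zpow`).

For uniqueness, let `V` and `W` be faithful irreducible representations over `K`. No nontrivial
element of `⟨a⟩` has a nonzero fixed vector, so over an algebraic closure of `K` the eigenvalues of
`a` on `V` and on `W` are primitive `n`-th roots of unity. An eigenvalue on `V` is thus the `k`-th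
power of one on `W`, and after twisting `W` by an automorphism of `G` both representations have a
common eigenvalue of `a`. Existence of a nonzero `⟨a⟩`-homomorphism `V → W` is the singularity of a
linear system over `K`, hence it descends from the algebraic closure
(`Representation.IsIrreducible.exists_linearMap_comp_eq_comp_pow`). Averaging it over the cosets of
`⟨a⟩` gives a nonzero `G`-homomorphism
(`Representation.IsIrreducible.nonempty_equiv_of_comp_eq_comp`), an isomorphism by Schur's lemma.
An isomorphism of representations up to an automorphism of `G` is a similarity of linear groups.

For existence, a faithful character of `⟨a⟩` over a cyclotomic extension of `K` is induced to `G`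
(`exists_faithful_isIrreducible`). The cyclic group of fourth roots of unity in `ℂ`, with its
tautological character and the inverse of that character, shows that the automorphism is needed.
-/

/-! ### Congruences for geometric sums -/

/-- If `r ≡ 1` modulo every prime divisor of `n`, and modulo `4` if `n` is even, then the sum of
the first `p` powers of `r` is `p` times a unit modulo `n`, for each prime divisor `p` of `n`. -/
lemma exists_geom_sum_eq_mul_isCoprime {n p : ℕ} (hp : p.Prime) {r : ℤ}
    (h : ∀ q : ℕ, q.Prime → q ∣ n → (q : ℤ) ∣ r - 1) (h2 : 2 ∣ n → (4 : ℤ) ∣ r - 1)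
    (hpn : p ∣ n) :
    ∃ u : ℤ, ∑ i ∈ Finset.range p, r ^ i = p * u ∧ IsCoprime u n := by
  obtain ⟨m, hm⟩ := h p hp hpn
  have hsq : (p : ℤ) ^ 2 ∣ ∑ i ∈ Finset.range p, r ^ i - p := by
    rcases hp.eq_two_or_odd' with rfl | hodd
    · obtain ⟨c, hc⟩ := h2 hpn
      exact ⟨c, by simp [Finset.sum_range_succ]; linarith⟩
    · have := odd_sq_dvd_geom_sum₂_sub (R := ℤ) (a := 1) (b := m) hodd
      have hr : r = 1 + p * m := by linarith
      simpa [hr] using this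
  obtain ⟨c, hc⟩ := hsq
  have hS : ∑ i ∈ Finset.range p, r ^ i = p * (1 + p * c) := by linear_combination hc
  refine ⟨1 + p * c, hS, ?_⟩
  rw [Int.isCoprime_iff_gcd_eq_one, Int.gcd_eq_natAbs]
  refine Nat.Coprime.symm (Nat.coprime_of_dvd fun q hq hqn hqu => ?_)
  simp only [Int.natAbs_natCast] at hqn
  have hqu' : (q : ℤ) ∣ 1 + p * c := by simpa [Int.natCast_dvd] using hqu
  have hq1 : ∀ i, (q : ℤ) ∣ r ^ i - 1 := fun i =>
    (h q hq hqn).trans (by simpa using sub_dvd_pow_sub_pow r 1 i)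
  have hqS : (q : ℤ) ∣ ∑ i ∈ Finset.range p, r ^ i - p := by
    have : ∑ i ∈ Finset.range p, r ^ i - (p : ℤ) = ∑ i ∈ Finset.range p, (r ^ i - 1) := by
      simp
    rw [this]
    exact Finset.dvd_sum fun i _ => hq1 i
  have hqp : (q : ℤ) ∣ p := by
    have h1 : (q : ℤ) ∣ ∑ i ∈ Finset.range p, r ^ i := hS ▸ hqu'.mul_left _
    simpa using dvd_sub h1 hqS
  have hqp' : q = p := (Nat.prime_dvd_prime_iff_eq hq hp).1 (by exact_mod_cast hqp)
  subst hqp'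
  have : (q : ℤ) ∣ 1 := (dvd_add_left (dvd_mul_right (q : ℤ) c)).1 hqu'
  exact hq.one_lt.ne' (by simpa using Int.eq_one_of_dvd_one (by positivity) this)

/-- If `r` has order `p` modulo `n` and `r ≡ 1` modulo every prime divisor of `n`, then
`p` is one of these prime divisors. -/
lemma dvd_of_dvd_pow_sub_one {n p : ℕ} (hp : p.Prime) {r : ℤ}
    (h : ∀ q : ℕ, q.Prime → q ∣ n → (q : ℤ) ∣ r - 1) (h1 : (n : ℤ) ∣ r ^ p - 1)
    (h2 : ¬ (n : ℤ) ∣ r - 1) : p ∣ n := by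
  by_contra hpn
  refine h2 (IsCoprime.dvd_of_dvd_mul_left (y := ∑ i ∈ Finset.range p, r ^ i) ?_ ?_)
  · rw [Int.isCoprime_iff_gcd_eq_one, Int.gcd_eq_natAbs]
    refine Nat.coprime_of_dvd fun q hq hqn hqu => ?_
    simp only [Int.natAbs_natCast] at hqn
    have hqu' : (q : ℤ) ∣ ∑ i ∈ Finset.range p, r ^ i := by simpa [Int.natCast_dvd] using hqu
    have hqS : (q : ℤ) ∣ ∑ i ∈ Finset.range p, r ^ i - p := by
      have : ∑ i ∈ Finset.range p, r ^ i - (p : ℤ) = ∑ i ∈ Finset.range p, (r ^ i - 1) := by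
        simp
      rw [this]
      exact Finset.dvd_sum fun i _ =>
        (h q hq hqn).trans (by simpa using sub_dvd_pow_sub_pow r 1 i)
    have hqp : (q : ℤ) ∣ p := by simpa using dvd_sub hqu' hqS
    have hqp' : q = p := (Nat.prime_dvd_prime_iff_eq hq hp).1 (by exact_mod_cast hqp)
    exact hpn (hqp' ▸ hqn)
  · rwa [geom_sum_mul]

/-! ### Normal subgroups of nilpotent groups -/

section

variable {G : Type*} [Group G]

/-- In a nilpotent group, a normal subgroup `C` not contained in `N` has an element outside `N`
that is central modulo `N`. -/
lemma Subgroup.exists_mem_notMem_forall_conj_mul_inv_mem [Group.IsNilpotent G] {N C : Subgroup G}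
    [C.Normal] (h : ¬ C ≤ N) : ∃ x ∈ C, x ∉ N ∧ ∀ g, g * x * g⁻¹ * x⁻¹ ∈ N := by
  obtain ⟨m, hm⟩ := Group.IsNilpotent.nilpotent (G := G)
  have hex : ∃ i, ¬ C ⊓ Subgroup.upperCentralSeries G i ≤ N := ⟨m, by simpa [hm] using h⟩
  classical
  obtain ⟨i, hi, hmin⟩ := Nat.findX hex
  obtain ⟨x, ⟨hxC, hxi⟩, hxN⟩ := SetLike.not_le_iff_exists.1 hi
  refine ⟨x, hxC, hxN, fun g => ?_⟩
  cases i with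
  | zero =>
    have hx1 : x = 1 := by simpa using hxi
    exact absurd (hx1 ▸ N.one_mem) hxN
  | succ i =>
    have hle := not_not.1 (hmin i (Nat.lt_succ_self i))
    refine hle ⟨C.mul_mem (‹C.Normal›.conj_mem _ hxC g) (C.inv_mem hxC), ?_⟩
    have := inv_mem (Subgroup.mem_upperCentralSeries_succ_iff.1 hxi g)
    simpa [commutatorElement_def, mul_assoc] using this

lemma Subgroup.normal_closure_of_forall_conj_mem {s : Set G}
    (h : ∀ g, ∀ x ∈ s, g * x * g⁻¹ ∈ Subgroup.closure s) : (Subgroup.closure s).Normal :=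
  Subgroup.normalizer_eq_top_iff.1 <| top_le_iff.1 <|
    Subgroup.le_normalizer_closure_iff.2 fun g _ => h g

/-- A finite nilpotent group has a self-centralizing abelian normal subgroup: any maximal abelian
normal subgroup is one. -/
lemma exists_normal_isMulCommutative_self_centralizing [Finite G] [Group.IsNilpotent G] :
    ∃ A : Subgroup G, A.Normal ∧ IsMulCommutative A ∧
      ∀ g, (∀ x ∈ A, g * x = x * g) → g ∈ A := by
  obtain ⟨A, ⟨hAn, hAc⟩, hmax⟩ := (Set.toFinite
    {A : Subgroup G | A.Normal ∧ IsMulCommutative A}).exists_maximal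
    ⟨⊥, inferInstance, inferInstance⟩
  refine ⟨A, hAn, hAc, ?_⟩
  have hAcomm : ∀ x ∈ A, ∀ y ∈ A, x * y = y * x := fun x hx y hy =>
    setLike_mul_comm hx hy
  by_contra! hcon
  obtain ⟨g, hg, hgA⟩ := hcon
  have hC : ¬ Subgroup.centralizer (A : Set G) ≤ A := fun hle =>
    hgA (hle (Subgroup.mem_centralizer_iff.2 fun x hx => (hg x hx).symm))
  obtain ⟨x, hxC, hxA, hx⟩ := Subgroup.exists_mem_notMem_forall_conj_mul_inv_mem hC
  have hxC' := Subgroup.mem_centralizer_iff.1 hxC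
  let B : Subgroup G := Subgroup.closure (insert x (A : Set G))
  have hAB : A ≤ B := fun y hy => Subgroup.subset_closure (Set.mem_insert_of_mem _ hy)
  have hxB : x ∈ B := Subgroup.subset_closure (Set.mem_insert _ _)
  have hBc : IsMulCommutative B := by
    refine Subgroup.isMulCommutative_closure ?_
    rintro y (rfl | hy) z (rfl | hz)
    · rfl
    · exact (hxC' z hz).symm
    · exact hxC' y hy
    · exact hAcomm y hy z hz
  have hBn : B.Normal := by
    refine Subgroup.normal_closure_of_forall_conj_mem fun g y hy => ?_
    rcases hy with rfl | hy
    · have := B.mul_mem (hAB (hx g)) hxB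
      rwa [inv_mul_cancel_right] at this
    · exact hAB (hAn.conj_mem y hy g)
  exact hxA (hmax ⟨hBn, hBc⟩ hAB hxB)

/-! ### A cyclic normal subgroup of index at most two -/

/-- An ANC group has a cyclic self-centralizing normal subgroup. -/
lemma IsANCGroup.exists_generator (hG : IsANCGroup G) :
    ∃ a : G, (Subgroup.zpowers a).Normal ∧ ∀ g, Commute g a → g ∈ Subgroup.zpowers a := by
  obtain ⟨hfin, hnil, hcyc⟩ := hG
  obtain ⟨A, hAn, hAc, hA⟩ := exists_normal_isMulCommutative_self_centralizing (G := G)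
  obtain ⟨a, rfl⟩ := (Subgroup.isCyclic_iff_exists_zpowers_eq_top A).1 (hcyc A hAn hAc)
  refine ⟨a, hAn, fun g hg => hA g fun x hx => ?_⟩
  obtain ⟨k, rfl⟩ := Subgroup.mem_zpowers_iff.1 hx
  exact hg.zpow_right k

variable {a : G}

lemma exists_conj_eq_zpow (ha : (Subgroup.zpowers a).Normal) (g : G) :
    ∃ r : ℤ, g * a * g⁻¹ = a ^ r := by
  obtain ⟨r, hr⟩ := Subgroup.mem_zpowers_iff.1 (ha.conj_mem a (Subgroup.mem_zpowers a) g)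
  exact ⟨r, hr.symm⟩

lemma conj_zpow_eq {g : G} {r : ℤ} (h : g * a * g⁻¹ = a ^ r) (i : ℤ) :
    g * a ^ i * g⁻¹ = a ^ (r * i) := by
  rw [← conj_zpow, h, ← zpow_mul]

lemma conj_zpow_of_eq_mul {g h : G} {r s : ℤ} (hg : g * a * g⁻¹ = a ^ r)
    (hh : h * a * h⁻¹ = a ^ s) : (g * h) * a * (g * h)⁻¹ = a ^ (r * s) := by
  rw [← conj_zpow_eq hg, ← hh]; group

lemma conj_pow_eq {g : G} {r : ℤ} (h : g * a * g⁻¹ = a ^ r) (m : ℕ) :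
    g ^ m * a * (g ^ m)⁻¹ = a ^ (r ^ m) := by
  induction m with
  | zero => simp
  | succ m ih => rw [pow_succ, pow_succ]; exact conj_zpow_of_eq_mul ih h

lemma normal_zpowers_of_mem (ha : (Subgroup.zpowers a).Normal) {x : G}
    (hx : x ∈ Subgroup.zpowers a) : (Subgroup.zpowers x).Normal := by
  obtain ⟨m, rfl⟩ := Subgroup.mem_zpowers_iff.1 hx
  rw [Subgroup.zpowers_eq_closure]
  refine Subgroup.normal_closure_of_forall_conj_mem fun g x hx => ?_
  rw [Set.mem_singleton_iff.1 hx, ← Subgroup.zpowers_eq_closure]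
  obtain ⟨s, hs⟩ := exists_conj_eq_zpow ha g
  refine Subgroup.mem_zpowers_iff.2 ⟨s, ?_⟩
  rw [conj_zpow_eq hs, ← zpow_mul, mul_comm]

lemma orderOf_pow_eq_of_eq_mul [Finite G] {q m : ℕ} (hm : orderOf a = q * m) :
    orderOf (a ^ m) = q := by
  have hpos := orderOf_pos a
  have hm0 : m ≠ 0 := by rintro rfl; simp [hm] at hpos
  rw [orderOf_pow_of_dvd hm0 (hm ▸ dvd_mul_left m q), hm]
  exact Nat.mul_div_cancel _ (Nat.pos_of_ne_zero hm0)

/-- A normal subgroup of prime order in a nilpotent group is central, so conjugation acts trivially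
on the subgroup of order `q` of a normal cyclic group. -/
lemma prime_dvd_sub_one_of_conj_eq [Finite G] [Group.IsNilpotent G]
    (ha : (Subgroup.zpowers a).Normal) {g : G} {r : ℤ} (h : g * a * g⁻¹ = a ^ r) {q : ℕ}
    (hq : q.Prime) (hqn : q ∣ orderOf a) : (q : ℤ) ∣ r - 1 := by
  obtain ⟨m, hm⟩ := hqn
  have hz : orderOf (a ^ m) = q := orderOf_pow_eq_of_eq_mul hm
  have hZn := normal_zpowers_of_mem ha (Subgroup.npow_mem_zpowers a m)
  have hnot : ¬ Subgroup.zpowers (a ^ m) ≤ ⊥ := fun hle => by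
    have h1 : a ^ m = 1 := by simpa using hle (Subgroup.mem_zpowers _)
    rw [h1, orderOf_one] at hz
    exact hq.one_lt.ne hz
  obtain ⟨x, hx, hx1, hxc⟩ := Subgroup.exists_mem_notMem_forall_conj_mul_inv_mem hnot
  obtain ⟨j, rfl⟩ := Subgroup.mem_zpowers_iff.1 hx
  have hc : g * (a ^ m) ^ j * g⁻¹ = (a ^ m) ^ j := by
    have := Subgroup.mem_bot.1 (hxc g)
    rwa [mul_inv_eq_one] at this
  have h1 : (a ^ m) ^ (j * (r - 1)) = 1 := by
    have h2 : g * (a ^ m) ^ j * g⁻¹ = (a ^ m) ^ (j * r) := by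
      rw [← zpow_natCast a m, ← zpow_mul, conj_zpow_eq h, ← zpow_mul]
      congr 1; ring
    rw [mul_sub, mul_one, zpow_sub, ← h2, hc, mul_inv_cancel]
  rw [← orderOf_dvd_iff_zpow_eq_one, hz] at h1
  refine ((Nat.prime_iff_prime_int.1 hq).dvd_or_dvd h1).resolve_left fun hj => hx1 ?_
  rw [Subgroup.mem_bot, ← orderOf_dvd_iff_zpow_eq_one, hz]
  exact hj

/-- Power maps commute, so commutators centralize the self-centralizing subgroup `⟨a⟩`. -/
lemma conj_mul_inv_mem_zpowers (ha : (Subgroup.zpowers a).Normal)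
    (hc : ∀ g, Commute g a → g ∈ Subgroup.zpowers a) (g h : G) :
    g * h * g⁻¹ * h⁻¹ ∈ Subgroup.zpowers a := by
  obtain ⟨r, hr⟩ := exists_conj_eq_zpow ha g
  obtain ⟨s, hs⟩ := exists_conj_eq_zpow ha h
  have h1 : g * h * a * (g * h)⁻¹ = h * g * a * (h * g)⁻¹ := by
    rw [conj_zpow_of_eq_mul hr hs, conj_zpow_of_eq_mul hs hr, mul_comm]
  obtain ⟨i, hi⟩ := Subgroup.mem_zpowers_iff.1 (hc ((h * g)⁻¹ * (g * h)) (by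
    rw [commute_iff_eq]
    calc (h * g)⁻¹ * (g * h) * a = (h * g)⁻¹ * (g * h * a * (g * h)⁻¹) * (g * h) := by group
      _ = a * ((h * g)⁻¹ * (g * h)) := by rw [h1]; group))
  have := ha.conj_mem _ (Subgroup.zpow_mem_zpowers a i) (h * g)
  rw [hi] at this
  convert this using 1
  group

lemma zpow_mul_pow_eq {g : G} {r : ℤ} (h : g * a * g⁻¹ = a ^ r) (i : ℤ) (m : ℕ) :
    (a ^ i * g) ^ m = a ^ (i * ∑ j ∈ Finset.range m, r ^ j) * g ^ m := by
  induction m with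
  | zero => simp
  | succ m ih =>
    have h1 := conj_zpow_eq h (i * ∑ j ∈ Finset.range m, r ^ j)
    rw [mul_inv_eq_iff_eq_mul] at h1
    have h2 : i * ∑ j ∈ Finset.range (m + 1), r ^ j =
        i + r * (i * ∑ j ∈ Finset.range m, r ^ j) := by
      rw [geom_sum_succ]; ring
    rw [pow_succ', ih, mul_assoc, ← mul_assoc g, h1, pow_succ' g, h2, zpow_add]
    simp only [mul_assoc]

/-- If `g ∉ ⟨a⟩` and `g ^ p ∈ ⟨a⟩`, then some `y = a ^ i * g` has order `p`, and together with the
subgroup of order `p` of `⟨a⟩` it generates a noncyclic abelian normal subgroup. -/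
lemma IsANCGroup.mem_zpowers_of_pow_prime_mem (hG : IsANCGroup G)
    (ha : (Subgroup.zpowers a).Normal) (hc : ∀ g, Commute g a → g ∈ Subgroup.zpowers a)
    {g : G} {r : ℤ} (h : g * a * g⁻¹ = a ^ r) (h2 : 2 ∣ orderOf a → (4 : ℤ) ∣ r - 1) {p : ℕ}
    (hp : p.Prime) (hgp : g ^ p ∈ Subgroup.zpowers a) : g ∈ Subgroup.zpowers a := by
  obtain ⟨hfin, hnil, hcyc⟩ := hG
  by_contra hg
  set n := orderOf a with hn
  have hzpow : ∀ i : ℤ, a ^ i = 1 ↔ (n : ℤ) ∣ i := fun i => orderOf_dvd_iff_zpow_eq_one.symm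
  have hpr := fun q hq hqn => prime_dvd_sub_one_of_conj_eq ha h (q := q) hq hqn
  obtain ⟨t, ht⟩ := Subgroup.mem_zpowers_iff.1 hgp
  have hr1 : ¬ (n : ℤ) ∣ r - 1 := fun hd => hg (hc g (by
    have : a ^ r = a := by
      have := (hzpow (r - 1)).2 hd
      rwa [zpow_sub_one, mul_inv_eq_one] at this
    rw [this, mul_inv_eq_iff_eq_mul] at h
    exact h))
  have hrp : (n : ℤ) ∣ r ^ p - 1 := by
    have h1 := conj_pow_eq h p
    rw [← ht, (Commute.refl a).zpow_left t |>.eq, mul_inv_cancel_right] at h1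
    rw [← hzpow, zpow_sub_one, ← h1, mul_inv_cancel]
  have hpn : p ∣ n := dvd_of_dvd_pow_sub_one hp hpr hrp hr1
  obtain ⟨u, hu, hun⟩ := exists_geom_sum_eq_mul_isCoprime hp hpr h2 hpn
  have hnp : (n : ℤ) ∣ p * (r - 1) := by
    rw [← geom_sum_mul, hu, mul_assoc, mul_left_comm] at hrp
    exact hun.symm.dvd_of_dvd_mul_left hrp
  obtain ⟨m, hm⟩ := hpn
  have hpos : 0 < n := orderOf_pos a
  have hm0 : (m : ℤ) ≠ 0 := by rintro h0; simp [hm, Int.natCast_eq_zero.1 h0] at hpos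
  have hp0 : (p : ℤ) ≠ 0 := by exact_mod_cast hp.ne_zero
  have hmr : (m : ℤ) ∣ r - 1 := by
    rw [hm, Nat.cast_mul] at hnp
    exact Int.dvd_of_mul_dvd_mul_left hp0 hnp
  obtain ⟨s, hs⟩ := hmr
  have hps : ¬ (p : ℤ) ∣ s := fun hps => hr1 (by
    rw [hs, hm, Nat.cast_mul, mul_comm (p : ℤ)]
    exact mul_dvd_mul_left _ hps)
  -- `g` centralizes `g ^ p = a ^ t`, which forces `p ∣ t`.
  have hpt : (p : ℤ) ∣ t := by
    have h1 := conj_zpow_eq h t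
    rw [ht, ← pow_succ', pow_succ, mul_inv_cancel_right, ← ht] at h1
    have h3 : (n : ℤ) ∣ t * (r - 1) := by
      rw [← hzpow, mul_sub, mul_one, zpow_sub, mul_comm t r, ← h1, mul_inv_cancel]
    rw [hs, hm, Nat.cast_mul, mul_comm (p : ℤ), mul_left_comm] at h3
    exact ((Nat.prime_iff_prime_int.1 hp).dvd_or_dvd
      (Int.dvd_of_mul_dvd_mul_left hm0 h3)).resolve_right hps
  obtain ⟨t', rfl⟩ := hpt
  obtain ⟨v, w, hvw⟩ := id hun
  -- `v` is an inverse of `u` modulo `n`, so `a ^ (-v * t')` corrects `g` to an element of order `p`.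
  set y := a ^ (-v * t') * g with hy
  have hyp : y ^ p = 1 := by
    rw [hy, zpow_mul_pow_eq h, ← ht, ← zpow_add, hzpow, hu]
    exact ⟨p * t' * w, by linear_combination (p * t') * (-hvw)⟩
  have hyA : y ∉ Subgroup.zpowers a := fun hyA =>
    hg ((Subgroup.mul_mem_cancel_left _ (Subgroup.zpow_mem_zpowers a _)).1 hyA)
  have hya : y * a * y⁻¹ = a ^ r := by
    calc y * a * y⁻¹ = a ^ (-v * t') * (g * a * g⁻¹) * (a ^ (-v * t'))⁻¹ := by rw [hy]; group
      _ = a ^ r := by rw [h]; group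
  set z := a ^ m with hz
  have hzo : orderOf z = p := orderOf_pow_eq_of_eq_mul hm
  have hyz : y * z * y⁻¹ = z := by
    rw [hz, ← zpow_natCast a m, conj_zpow_eq hya, ← mul_inv_eq_one, ← zpow_neg, ← zpow_add, hzpow,
      hm]
    obtain ⟨c, hc⟩ := hpr p hp ⟨m, hm⟩
    exact ⟨c, by push_cast; linear_combination (m : ℤ) * hc⟩
  rw [mul_inv_eq_iff_eq_mul] at hyz
  set N := Subgroup.closure {y, z} with hN
  have hyN : y ∈ N := Subgroup.subset_closure (by simp)
  have hzN : z ∈ N := Subgroup.subset_closure (by simp)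
  have hNc : IsMulCommutative N := by
    refine Subgroup.isMulCommutative_closure ?_
    rintro x (rfl | rfl) x' (rfl | rfl)
    exacts [rfl, hyz, hyz.symm, rfl]
  have hNn : N.Normal := by
    refine Subgroup.normal_closure_of_forall_conj_mem fun f x hx => ?_
    rcases hx with rfl | rfl
    · -- The conjugate `a ^ j * y` also has order `p`, which forces `a ^ j ∈ ⟨z⟩`.
      obtain ⟨j, hj⟩ := Subgroup.mem_zpowers_iff.1 (conj_mul_inv_mem_zpowers ha hc f y)
      have hj' : f * y * f⁻¹ = a ^ j * y := by rw [hj, inv_mul_cancel_right]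
      have hjp : (a ^ j * y) ^ p = 1 := by rw [← hj', conj_pow, hyp]; simp
      rw [zpow_mul_pow_eq hya, hyp, mul_one, hzpow, hu, ← mul_assoc] at hjp
      have hjp' := hun.symm.dvd_of_dvd_mul_right hjp
      rw [← hn, hm, Nat.cast_mul, mul_comm (p : ℤ)] at hjp'
      obtain ⟨i, rfl⟩ := Int.dvd_of_mul_dvd_mul_right hp0 hjp'
      rw [hj', zpow_mul, zpow_natCast]
      exact N.mul_mem (N.zpow_mem hzN i) hyN
    · obtain ⟨i, hi⟩ := exists_conj_eq_zpow ha f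
      have : f * z * f⁻¹ = z ^ i := by
        rw [hz, ← zpow_natCast a m, conj_zpow_eq hi, ← zpow_mul, mul_comm]
      rw [this]
      exact N.zpow_mem hzN i
  have hNp : ∀ x ∈ N, x ^ p = 1 := by
    intro x hx
    induction hx using Subgroup.closure_induction with
    | mem x hx =>
      rcases hx with rfl | rfl
      · exact hyp
      · rw [← hzo, pow_orderOf_eq_one]
    | one => exact one_pow p
    | mul x x' hx hx' h1 h2 =>
      rw [Commute.mul_pow (setLike_mul_comm (s := N) hx hx'), h1, h2, one_mul]
    | inv x hx h1 => rw [inv_pow, h1, inv_one]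
  obtain ⟨x, hx⟩ := (Subgroup.isCyclic_iff_exists_zpowers_eq_top N).1 (hcyc N hNn hNc)
  have hle : Subgroup.zpowers z ≤ Subgroup.zpowers x := by
    rw [hx]; exact (Subgroup.zpowers_le).2 hzN
  have hxp : orderOf x ≤ p :=
    Nat.le_of_dvd hp.pos (orderOf_dvd_of_pow_eq_one (hNp x (hx ▸ Subgroup.mem_zpowers x)))
  have heq := Subgroup.eq_of_le_of_card_ge hle (by rwa [Nat.card_zpowers, Nat.card_zpowers, hzo])
  rw [hx] at heq
  exact hyA ((Subgroup.zpowers_le.2 (Subgroup.npow_mem_zpowers a m)) (heq ▸ hyN))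

/-- If `⟨a⟩` has even order, an element outside `⟨a⟩` acts on it by an exponent `r` that is not
`1` modulo `4`; if `⟨a⟩` has odd order, it is the whole group. -/
lemma IsANCGroup.mem_zpowers_of_conj_eq (hG : IsANCGroup G)
    (ha : (Subgroup.zpowers a).Normal) (hc : ∀ g, Commute g a → g ∈ Subgroup.zpowers a)
    {g : G} {r : ℤ} (h : g * a * g⁻¹ = a ^ r) (h2 : 2 ∣ orderOf a → (4 : ℤ) ∣ r - 1) :
    g ∈ Subgroup.zpowers a := by
  have := hG.1
  suffices H : ∀ k : ℕ, k ≠ 0 → ∀ (g : G) (r : ℤ), g * a * g⁻¹ = a ^ r →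
      (2 ∣ orderOf a → (4 : ℤ) ∣ r - 1) → g ^ k ∈ Subgroup.zpowers a →
      g ∈ Subgroup.zpowers a from
    H (orderOf g) (orderOf_pos g).ne' g r h h2 (by rw [pow_orderOf_eq_one]; exact one_mem _)
  intro k
  induction k using induction_on_primes with
  | zero => exact fun h0 => absurd rfl h0
  | one => intro _ g r _ _ hg; rwa [pow_one] at hg
  | prime_mul p k hp ih =>
    intro hk g r h h2 hg
    refine hG.mem_zpowers_of_pow_prime_mem ha hc h h2 hp ?_
    refine ih (right_ne_zero_of_mul hk) (g ^ p) (r ^ p) (conj_pow_eq h p) (fun hd => ?_)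
      (by rwa [← pow_mul])
    exact (h2 hd).trans (by simpa using sub_dvd_pow_sub_pow r 1 p)

/-- A self-centralizing cyclic normal subgroup of an ANC group has index at most two. -/
lemma IsANCGroup.mul_mem_zpowers (hG : IsANCGroup G)
    (ha : (Subgroup.zpowers a).Normal) (hc : ∀ g, Commute g a → g ∈ Subgroup.zpowers a)
    {g h : G} (hg : g ∉ Subgroup.zpowers a) (hh : h ∉ Subgroup.zpowers a) :
    g * h ∈ Subgroup.zpowers a := by
  have := hG.1
  have := hG.2.1
  -- An element outside `⟨a⟩` acts on `⟨a⟩` by an exponent that is `3` modulo `4`.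
  have key : ∀ g, g ∉ Subgroup.zpowers a →
      ∃ r : ℤ, g * a * g⁻¹ = a ^ r ∧ r % 4 = 3 := by
    intro g hg
    obtain ⟨r, hr⟩ := exists_conj_eq_zpow ha g
    have h2 : 2 ∣ orderOf a := by
      by_contra h2
      exact hg (hG.mem_zpowers_of_conj_eq ha hc hr fun h => absurd h h2)
    have hr2 := prime_dvd_sub_one_of_conj_eq ha hr Nat.prime_two h2
    push_cast at hr2
    have h1 : ¬ r % 4 = 1 := fun h1 => hg (hG.mem_zpowers_of_conj_eq ha hc hr fun _ => by omega)
    exact ⟨r, hr, by omega⟩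
  obtain ⟨r, hr, hr4⟩ := key g hg
  obtain ⟨s, hs, hs4⟩ := key h hh
  refine hG.mem_zpowers_of_conj_eq ha hc (conj_zpow_of_eq_mul hr hs) fun _ => ?_
  have : r * s % 4 = 1 := by rw [Int.mul_emod, hr4, hs4]; rfl
  omega

/-- If `⟨a⟩` is normal of index at most two, then `a ↦ a ^ k` extends to an automorphism for
every odd `k` prime to the order of `a`. The extension sends `b ∉ ⟨a⟩` to `b ^ k`, which acts on
`⟨a⟩` as `b` does because `b ^ 2 ∈ ⟨a⟩` and `k` is odd. -/
lemma exists_mulEquiv_eq_zpow [Finite G] (ha : (Subgroup.zpowers a).Normal)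
    (hind : ∀ g h, g ∉ Subgroup.zpowers a → h ∉ Subgroup.zpowers a → g * h ∈ Subgroup.zpowers a)
    {k : ℤ} (hodd : Odd k) (hk : IsCoprime k (orderOf a)) :
    ∃ α : G ≃* G, ∀ x ∈ Subgroup.zpowers a, α x = x ^ k := by
  classical
  set A := Subgroup.zpowers a with hA
  have hcomm : ∀ x ∈ A, ∀ y ∈ A, Commute x y := fun x hx y hy => setLike_mul_comm hx hy
  obtain ⟨l, hl⟩ := hodd
  -- If `A` is the whole group, the choice of `b` is irrelevant.
  obtain ⟨b, hb⟩ : ∃ b, ∀ g ∉ A, b ∉ A := by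
    by_cases h : ∃ b, b ∉ A
    · exact h.imp fun b hb _ _ => hb
    · exact ⟨1, fun g hg => absurd ⟨g, hg⟩ h⟩
  have hdiv : ∀ g ∉ A, g * b⁻¹ ∈ A := fun g hg =>
    hind g b⁻¹ hg fun h => hb g hg (inv_mem_iff.1 h)
  set c := (b * b) ^ l with hc
  have hcA : ∀ g ∉ A, c ∈ A := fun g hg => A.zpow_mem (hind b b (hb g hg) (hb g hg)) l
  have hbb : Commute b (b * b) := (Commute.refl b).mul_right (Commute.refl b)
  have hbc : Commute b c := hbb.zpow_right l
  let f : G → G := fun g => if g ∈ A then g ^ k else (g * b⁻¹) ^ k * c * b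
  have hfA : ∀ g ∈ A, f g = g ^ k := fun g hg => if_pos hg
  have hfb : ∀ g ∉ A, f g = (g * b⁻¹) ^ k * c * b := fun g hg => if_neg hg
  have hf : ∀ g h, f (g * h) = f g * f h := by
    intro g h
    by_cases hg : g ∈ A <;> by_cases hh : h ∈ A
    · rw [hfA g hg, hfA h hh, hfA _ (A.mul_mem hg hh), (hcomm g hg h hh).mul_zpow]
    · rw [hfA g hg, hfb h hh, hfb _ (by rwa [A.mul_mem_cancel_left hg]), mul_assoc g,
        (hcomm g hg _ (hdiv h hh)).mul_zpow]
      simp only [mul_assoc]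
    · have hx := hdiv g hg
      have hy := ha.conj_mem h hh b
      have hyk := ha.conj_mem _ (A.zpow_mem hh k) b
      have e : g * h * b⁻¹ = (g * b⁻¹) * (b * h * b⁻¹) := by group
      rw [hfA h hh, hfb g hg, hfb _ (by rwa [A.mul_mem_cancel_right hh]), e,
        (hcomm _ hx _ hy).mul_zpow, conj_zpow, mul_assoc _ _ c,
        (hcomm _ hyk _ (hcA g hg)).eq]
      group
    · have hx := hdiv g hg
      have hz := hdiv h hh
      have hy := ha.conj_mem _ hz b
      have hyk := ha.conj_mem _ (A.zpow_mem hz k) b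
      have hq := hind b b (hb g hg) (hb g hg)
      have e : g * h = (g * b⁻¹) * (b * (h * b⁻¹) * b⁻¹) * (b * b) := by group
      have e2 : (b * b) ^ k = c * c * (b * b) := by
        rw [hl, zpow_add, two_mul, zpow_add, zpow_one]
      rw [hfb g hg, hfb h hh, hfA _ (hind g h hg hh), e,
        (hcomm _ (A.mul_mem hx hy) _ hq).mul_zpow, (hcomm _ hx _ hy).mul_zpow, conj_zpow, e2]
      calc _ = (g * b⁻¹) ^ k * ((b * (h * b⁻¹) ^ k * b⁻¹) * c) * c * (b * b) := by
            simp only [mul_assoc]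
        _ = (g * b⁻¹) ^ k * c * b * (h * b⁻¹) ^ k * b⁻¹ * (c * b) * b := by
            rw [(hcomm _ hyk _ (hcA g hg)).eq]; simp only [mul_assoc]
        _ = _ := by rw [← hbc.eq]; simp only [mul_assoc, inv_mul_cancel_left]
  have hinj : Function.Injective (MonoidHom.mk' f hf) := by
    rw [injective_iff_map_eq_one]
    intro g hg
    rw [MonoidHom.mk'_apply] at hg
    by_cases hgA : g ∈ A
    · rw [hfA g hgA] at hg
      obtain ⟨i, rfl⟩ := Subgroup.mem_zpowers_iff.1 hgA
      rw [← zpow_mul, ← orderOf_dvd_iff_zpow_eq_one] at hg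
      exact orderOf_dvd_iff_zpow_eq_one.1 (hk.symm.dvd_of_dvd_mul_right hg)
    · rw [hfb g hgA] at hg
      refine absurd ?_ (hb g hgA)
      rw [eq_inv_of_mul_eq_one_right hg]
      exact A.inv_mem (A.mul_mem (A.zpow_mem (hdiv g hgA) k) (hcA g hgA))
  exact ⟨MulEquiv.ofBijective _ (Finite.injective_iff_bijective.1 hinj), hfA⟩

end

/-! ### Irreducible representations of finite groups -/

section

variable {G K V W : Type*} [Group G] [Field K] [AddCommGroup V] [Module K V] [AddCommGroup W]
  [Module K W]

lemma Representation.isIrreducible_iff_forall_submodule (ρ : Representation K G V) :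
    ρ.IsIrreducible ↔ Nontrivial V ∧
      ∀ p : Submodule K V, (∀ g, ∀ v ∈ p, ρ g v ∈ p) → p = ⊥ ∨ p = ⊤ := by
  constructor
  · intro h
    refine ⟨?_, fun p hp => ?_⟩
    · by_contra hV
      rw [not_nontrivial_iff_subsingleton] at hV
      exact bot_ne_top (α := Subrepresentation ρ)
        (Subrepresentation.toSubmodule_injective (Subsingleton.elim _ _))
    · rcases h.eq_bot_or_eq_top (⟨p, fun g v hv => hp g v hv⟩ : Subrepresentation ρ) with h | h
      · exact Or.inl (congrArg Subrepresentation.toSubmodule h)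
      · exact Or.inr (congrArg Subrepresentation.toSubmodule h)
  · rintro ⟨hV, h⟩
    have hne : (⊥ : Subrepresentation ρ) ≠ ⊤ := fun h0 =>
      bot_ne_top (α := Submodule K V) (congrArg Subrepresentation.toSubmodule h0)
    exact { exists_pair_ne := ⟨_, _, hne⟩
            eq_bot_or_eq_top := fun p => (h p.toSubmodule fun g v hv =>
                p.apply_mem_toSubmodule g hv).imp
              (fun h => Subrepresentation.toSubmodule_injective h)
              (fun h => Subrepresentation.toSubmodule_injective h) }

/-- A representation is irreducible if its operators include, up to a linear isomorphism, those of
an irreducible representation. The map `f` between the groups need not be a homomorphism. -/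
lemma Representation.IsIrreducible.of_equiv {H : Type*} [Group H] {ρ : Representation K G V}
    {σ : Representation K H W} (hρ : ρ.IsIrreducible) (e : V ≃ₗ[K] W) (f : G → H)
    (h : ∀ g v, e (ρ g v) = σ (f g) (e v)) : σ.IsIrreducible := by
  rw [Representation.isIrreducible_iff_forall_submodule] at hρ ⊢
  obtain ⟨hV, hρ⟩ := hρ
  refine ⟨e.symm.toEquiv.nontrivial, fun p hp => ?_⟩
  have hinv : ∀ g, ∀ v ∈ p.comap e.toLinearMap, ρ g v ∈ p.comap e.toLinearMap := fun g v hv => by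
    simpa [h] using hp (f g) _ hv
  refine (hρ _ hinv).imp (fun h0 => ?_) (fun h0 => ?_)
  · rw [eq_bot_iff]
    intro w hw
    have : e.symm w ∈ p.comap e.toLinearMap := by simpa using hw
    rw [h0] at this
    simpa using this
  · rw [eq_top_iff]
    intro w _
    have : e.symm w ∈ p.comap e.toLinearMap := h0 ▸ Submodule.mem_top
    simpa using this

lemma Representation.IsIrreducible.finiteDimensional [Finite G] {ρ : Representation K G V}
    (hρ : ρ.IsIrreducible) : FiniteDimensional K V := by
  rw [Representation.isIrreducible_iff_forall_submodule] at hρ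
  obtain ⟨hV, hρ⟩ := hρ
  obtain ⟨v, hv⟩ := exists_ne (0 : V)
  have hS : Submodule.span K (Set.range fun g => ρ g v) = ⊤ := by
    refine (hρ _ fun g w hw => ?_).resolve_left fun h0 => hv ?_
    · induction hw using Submodule.span_induction with
      | mem x hx =>
        obtain ⟨h, rfl⟩ := hx
        exact Submodule.subset_span ⟨g * h, by simp⟩
      | zero => simp
      | add x y _ _ hx hy => rw [map_add]; exact add_mem hx hy
      | smul c x _ hx => rw [map_smul]; exact Submodule.smul_mem _ c hx
    · have : v ∈ Submodule.span K (Set.range fun g => ρ g v) :=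
        Submodule.subset_span ⟨1, by simp⟩
      rwa [h0, Submodule.mem_bot] at this
  exact .of_fg_top (hS ▸ Submodule.fg_span (Set.finite_range _))

/-- If `⟨x⟩` is normal, then `x ≠ 1` has no fixed vector in a faithful irreducible
representation: the fixed space is invariant. -/
lemma Representation.IsIrreducible.eq_zero_of_apply_eq {ρ : Representation K G V}
    (hρ : ρ.IsIrreducible) (hinj : Function.Injective ρ) {x : G}
    (hx : (Subgroup.zpowers x).Normal) (hx1 : x ≠ 1) {v : V} (hv : ρ x v = v) : v = 0 := by
  rw [Representation.isIrreducible_iff_forall_submodule] at hρ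
  have hpow : ∀ w : V, ρ x w = w → ∀ i : ℤ, ρ (x ^ i) w = w := by
    intro w hw i
    have hinv : ρ x⁻¹ w = w := by
      conv_lhs => rw [← hw]
      simp
    induction i with
    | zero => simp
    | succ i ih => rw [zpow_add_one, map_mul, Module.End.mul_apply, hw, ih]
    | pred i ih => rw [zpow_sub_one, map_mul, Module.End.mul_apply, hinv, ih]
  have hinv : ∀ g, ∀ w ∈ LinearMap.ker (ρ x - 1), ρ g w ∈ LinearMap.ker (ρ x - 1) := by
    intro g w hw
    have hw' : ρ x w = w := by simpa [sub_eq_zero] using hw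
    obtain ⟨i, hi⟩ := Subgroup.mem_zpowers_iff.1 (hx.conj_mem x (Subgroup.mem_zpowers x) g⁻¹)
    rw [inv_inv] at hi
    have e : x * g = g * x ^ i := by rw [hi]; group
    simp only [LinearMap.mem_ker, LinearMap.sub_apply, Module.End.one_apply, sub_eq_zero]
    rw [← Module.End.mul_apply, ← map_mul, e, map_mul, Module.End.mul_apply, hpow w hw']
  rcases hρ.2 _ hinv with h0 | h0
  · have : v ∈ LinearMap.ker (ρ x - 1) := by simp [hv]
    rwa [h0, Submodule.mem_bot] at this
  · refine absurd (hinj ?_) hx1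
    rw [map_one, ← sub_eq_zero, ← LinearMap.ker_eq_top, h0]

end

/-! ### Eigenvalues and intertwining matrices -/

section

open scoped Matrix Kronecker

variable {K ι κ : Type*} [Field K] [Fintype ι] [DecidableEq ι] [Fintype κ] [DecidableEq κ]

lemma Matrix.kronecker_sub_kronecker_mulVec_apply {R : Type*} [CommRing R] (M : Matrix ι ι R)
    (N : Matrix κ κ R) (x : ι × κ → R) (i : ι) (j : κ) :
    ((Mᵀ ⊗ₖ 1 - 1 ⊗ₖ N) *ᵥ x) (i, j) =
      ∑ i', M i' i * x (i', j) - ∑ j', N j j' * x (i, j') := by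
  simp only [Matrix.mulVec, dotProduct, Matrix.sub_apply, Matrix.kronecker_apply, sub_mul,
    Finset.sum_sub_distrib, Fintype.sum_prod_type, Matrix.one_apply, Matrix.transpose_apply]
  simp

/-- If `Mᵀ` and `N` have a common eigenvalue in an extension field, then `X * M = N * X` has a
nonzero solution over the base field: it is a singular linear system. -/
lemma Matrix.exists_ne_zero_mul_eq_mul {L : Type*} [Field L] [Algebra K L] (M : Matrix ι ι K)
    (N : Matrix κ κ K) {ζ : L} {v : ι → L} {w : κ → L} (hv : v ≠ 0) (hw : w ≠ 0)
    (hMv : (Mᵀ.map (algebraMap K L)) *ᵥ v = ζ • v) (hNw : (N.map (algebraMap K L)) *ᵥ w = ζ • w) :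
    ∃ X : Matrix κ ι K, X ≠ 0 ∧ X * M = N * X := by
  have hSL : ((Mᵀ ⊗ₖ 1 - 1 ⊗ₖ N : Matrix (ι × κ) (ι × κ) K).map (algebraMap K L)) *ᵥ
      (fun p => v p.1 * w p.2) = 0 := by
    have hmap : (Mᵀ ⊗ₖ 1 - 1 ⊗ₖ N : Matrix (ι × κ) (ι × κ) K).map (algebraMap K L) =
        (M.map (algebraMap K L))ᵀ ⊗ₖ 1 - 1 ⊗ₖ N.map (algebraMap K L) := by
      ext p q
      simp [Matrix.one_apply, apply_ite (algebraMap K L)]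
    ext ⟨i, j⟩
    have h1 := congrFun hMv i
    have h2 := congrFun hNw j
    simp only [Matrix.mulVec, dotProduct, Matrix.map_apply, Matrix.transpose_apply,
      Pi.smul_apply, smul_eq_mul] at h1 h2
    rw [hmap, Matrix.kronecker_sub_kronecker_mulVec_apply]
    simp only [Matrix.map_apply, Pi.zero_apply, ← mul_assoc, ← Finset.sum_mul]
    simp only [mul_assoc, mul_left_comm _ (v i), ← Finset.mul_sum]
    rw [h1, h2]
    ring
  have hne : (fun p : ι × κ => v p.1 * w p.2) ≠ 0 := by
    obtain ⟨i, hi⟩ := Function.ne_iff.1 hv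
    obtain ⟨j, hj⟩ := Function.ne_iff.1 hw
    exact Function.ne_iff.2 ⟨(i, j), mul_ne_zero hi hj⟩
  have hdet : (Mᵀ ⊗ₖ 1 - 1 ⊗ₖ N : Matrix (ι × κ) (ι × κ) K).det = 0 := by
    have h := Matrix.exists_mulVec_eq_zero_iff.1 ⟨_, hne, hSL⟩
    rw [← RingHom.mapMatrix_apply, ← RingHom.map_det] at h
    exact (map_eq_zero _).1 h
  obtain ⟨x, hx, hx0⟩ := Matrix.exists_mulVec_eq_zero_iff.2 hdet
  refine ⟨Matrix.of fun j i => x (i, j), fun h0 => hx ?_, ?_⟩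
  · ext ⟨i, j⟩
    exact congrFun (congrFun h0 j) i
  · ext j i
    have := Matrix.kronecker_sub_kronecker_mulVec_apply M N x i j
    rw [hx0, Pi.zero_apply, eq_comm, sub_eq_zero] at this
    simp only [Matrix.mul_apply, Matrix.of_apply]
    rw [← this]
    exact Finset.sum_congr rfl fun _ _ => mul_comm _ _

/-- The eigenvalues of `M` are primitive `n`-th roots of unity if `M ^ n = 1` and no `M ^ i` with
`n ∤ i` has the eigenvalue `1`. -/
lemma Matrix.exists_isPrimitiveRoot_eigenvector [Nonempty ι] {L : Type*} [Field L] [IsAlgClosed L]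
    [Algebra K L] {M : Matrix ι ι K} {n : ℕ} (hM : M ^ n = 1)
    (h : ∀ i, (M ^ i - 1).det = 0 → n ∣ i) :
    ∃ (ζ : L) (v : ι → L), IsPrimitiveRoot ζ n ∧ v ≠ 0 ∧
      (M.map (algebraMap K L)) *ᵥ v = ζ • v := by
  obtain ⟨ζ, hζ⟩ := Module.End.exists_eigenvalue (Matrix.mulVecLin (M.map (algebraMap K L)))
  obtain ⟨v, hv⟩ := hζ.exists_hasEigenvector
  have hv1 : (M.map (algebraMap K L)) *ᵥ v = ζ • v := hv.apply_eq_smul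
  have hpow : ∀ i : ℕ, ((M ^ i).map (algebraMap K L)) *ᵥ v = ζ ^ i • v := by
    intro i
    induction i with
    | zero => simp
    | succ i ih =>
      rw [pow_succ, Matrix.map_mul, ← Matrix.mulVec_mulVec, hv1, Matrix.mulVec_smul, ih, smul_smul,
        pow_succ']
  refine ⟨ζ, v, ⟨?_, fun i hi => h i ?_⟩, hv.2, hv1⟩
  · have := hpow n
    rw [hM, Matrix.map_one _ (map_zero _) (map_one _), Matrix.one_mulVec] at this
    have h1 : (ζ ^ n - 1) • v = 0 := by rw [sub_smul, one_smul, ← this, sub_self]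
    exact sub_eq_zero.1 ((smul_eq_zero.1 h1).resolve_right hv.2)
  · have h0 : (((M ^ i - 1).map (algebraMap K L)) *ᵥ v) = 0 := by
      rw [Matrix.map_sub _ (map_sub _), Matrix.sub_mulVec, hpow, hi,
        Matrix.map_one _ (map_zero _) (map_one _), Matrix.one_mulVec, one_smul, sub_self]
    have := Matrix.exists_mulVec_eq_zero_iff.1 ⟨v, hv.2, h0⟩
    rw [← RingHom.mapMatrix_apply, ← RingHom.map_det] at this
    exact (map_eq_zero _).1 this

end

/-! ### Uniqueness up to automorphisms -/

section

variable {G K V W : Type*} [Group G] [Field K] [AddCommGroup V] [Module K V]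
  [AddCommGroup W] [Module K W] {a : G}

lemma Representation.IsIrreducible.dvd_of_det_toMatrix_pow_sub_one_eq_zero {ι : Type*} [Fintype ι]
    [DecidableEq ι] {ρ : Representation K G V} (hρ : ρ.IsIrreducible)
    (hinj : Function.Injective ρ) (ha : (Subgroup.zpowers a).Normal) (b : Module.Basis ι K V)
    (i : ℕ) (h : (LinearMap.toMatrix b b (ρ a) ^ i - 1).det = 0) : orderOf a ∣ i := by
  have e : LinearMap.toMatrix b b (ρ a) ^ i - 1 = LinearMap.toMatrix b b (ρ (a ^ i) - 1) := by
    rw [map_sub, LinearMap.toMatrix_one, map_pow, LinearMap.toMatrix_pow]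
  rw [e, LinearMap.det_toMatrix] at h
  have hker := (LinearMap.bot_lt_ker_of_det_eq_zero h).ne'
  obtain ⟨v, hv, hv0⟩ := Submodule.exists_mem_ne_zero_of_ne_bot hker
  by_contra hi
  refine hv0 (hρ.eq_zero_of_apply_eq hinj
    (normal_zpowers_of_mem ha (Subgroup.npow_mem_zpowers a i))
    (fun h1 => hi (orderOf_dvd_of_pow_eq_one h1)) ?_)
  simpa [sub_eq_zero] using hv

/-- The restrictions of two faithful irreducible representations to a cyclic normal subgroup `⟨a⟩`
have a common constituent, up to a power map: over an algebraic closure, the eigenvalues of `a` are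
primitive `n`-th roots of unity in both, and any two of these are powers of each other. -/
lemma Representation.IsIrreducible.exists_linearMap_comp_eq_comp_pow [Finite G]
    {ρ : Representation K G V} {σ : Representation K G W}
    (hρ : ρ.IsIrreducible) (hρ' : Function.Injective ρ) (hσ : σ.IsIrreducible)
    (hσ' : Function.Injective σ) (ha : (Subgroup.zpowers a).Normal) :
    ∃ (k : ℕ) (X : V →ₗ[K] W), Odd k ∧ k.Coprime (orderOf a) ∧ X ≠ 0 ∧
      X ∘ₗ ρ a = σ (a ^ k) ∘ₗ X := by
  have := hρ.finiteDimensional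
  have := hσ.finiteDimensional
  have := ((Representation.isIrreducible_iff_forall_submodule ρ).1 hρ).1
  have := ((Representation.isIrreducible_iff_forall_submodule σ).1 hσ).1
  let b := Module.finBasis K V
  let c := Module.finBasis K W
  have := b.index_nonempty
  have := c.index_nonempty
  set M := LinearMap.toMatrix b b (ρ a) with hM
  set N := LinearMap.toMatrix c c (σ a) with hN
  have hpos := orderOf_pos a
  have : NeZero (orderOf a) := ⟨hpos.ne'⟩
  have hMn : M ^ orderOf a = 1 := by
    rw [hM, LinearMap.toMatrix_pow, ← map_pow, pow_orderOf_eq_one, map_one,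
      LinearMap.toMatrix_one]
  have hNn : N ^ orderOf a = 1 := by
    rw [hN, LinearMap.toMatrix_pow, ← map_pow, pow_orderOf_eq_one, map_one,
      LinearMap.toMatrix_one]
  obtain ⟨ζ, v, hζ, hv0, hv⟩ := Matrix.exists_isPrimitiveRoot_eigenvector
    (L := AlgebraicClosure K) (M := M.transpose) (n := orderOf a)
    (by rw [← Matrix.transpose_pow, hMn, Matrix.transpose_one]) (fun i hi => by
      rw [← Matrix.transpose_pow, ← Matrix.transpose_one, ← Matrix.transpose_sub,
        Matrix.det_transpose] at hi
      exact hρ.dvd_of_det_toMatrix_pow_sub_one_eq_zero hρ' ha b i hi)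
  obtain ⟨ξ, w, hξ, hw0, hw⟩ := Matrix.exists_isPrimitiveRoot_eigenvector
    (L := AlgebraicClosure K) (M := N) hNn (fun i hi =>
      hσ.dvd_of_det_toMatrix_pow_sub_one_eq_zero hσ' ha c i hi)
  obtain ⟨k, hodd, hk, hkζ⟩ : ∃ k : ℕ, Odd k ∧ k.Coprime (orderOf a) ∧ ξ ^ k = ζ := by
    obtain ⟨k, -, hk, hkζ⟩ := hξ.isPrimitiveRoot_iff.1 hζ
    rcases Nat.even_or_odd k with he | ho
    · -- Here `orderOf a` is odd, so `k` may be replaced by `k + orderOf a`.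
      have hn : Odd (orderOf a) := by
        rw [← Nat.not_even_iff_odd]
        intro hn
        have := Nat.dvd_gcd he.two_dvd hn.two_dvd
        rw [hk] at this
        omega
      exact ⟨k + orderOf a, he.add_odd hn, by simpa using hk, by
        rw [pow_add, hξ.pow_eq_one, mul_one, hkζ]⟩
    · exact ⟨k, ho, hk, hkζ⟩
  have hwk : ((N ^ k).map (algebraMap K (AlgebraicClosure K))).mulVec w = ζ • w := by
    rw [← hkζ]
    clear hkζ hodd hk
    induction k with
    | zero => simp
    | succ i ih =>
      rw [pow_succ, Matrix.map_mul, ← Matrix.mulVec_mulVec, hw, Matrix.mulVec_smul, ih, smul_smul,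
        pow_succ']
  obtain ⟨X, hX0, hX⟩ := Matrix.exists_ne_zero_mul_eq_mul M (N ^ k) hv0 hw0 hv hwk
  refine ⟨k, Matrix.toLin b c X, hodd, hk, by simpa using hX0, ?_⟩
  apply (LinearMap.toMatrix b c).injective
  rw [LinearMap.toMatrix_comp b b c, LinearMap.toMatrix_comp b c c, LinearMap.toMatrix_toLin,
    map_pow, ← LinearMap.toMatrix_pow]
  exact hX

/-- Irreducible representations with a common constituent on a self-centralizing normal subgroup
`⟨a⟩` of index at most two are equivalent. An `⟨a⟩`-homomorphism `X` is averaged over the cosets of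
`⟨a⟩`; if `X` and `X * a` both average to zero, then `X * (a - b⁻¹ * a * b) = 0`, where
`a - b⁻¹ * a * b` is invertible. -/
lemma Representation.IsIrreducible.nonempty_equiv_of_comp_eq_comp [Finite G]
    {ρ : Representation K G V} {σ : Representation K G W}
    (hρ : ρ.IsIrreducible) (hρ' : Function.Injective ρ) (hσ : σ.IsIrreducible)
    (ha : (Subgroup.zpowers a).Normal) (hc : ∀ g, Commute g a → g ∈ Subgroup.zpowers a)
    (hind : ∀ g h, g ∉ Subgroup.zpowers a → h ∉ Subgroup.zpowers a → g * h ∈ Subgroup.zpowers a)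
    {X : V →ₗ[K] W} (hX0 : X ≠ 0)
    (hX : ∀ x ∈ Subgroup.zpowers a, ∀ v, X (ρ x v) = σ x (X v)) : Nonempty (ρ.Equiv σ) := by
  suffices H : ∃ Y : ρ.IntertwiningMap σ, Y ≠ 0 by
    obtain ⟨Y, hY⟩ := H
    exact ⟨Y.ofBijective ((Representation.IsIrreducible.bijective_or_eq_zero Y).resolve_right hY)⟩
  have := hρ.finiteDimensional
  have hmul : ∀ g h v, ρ (g * h) v = ρ g (ρ h v) := fun g h v => by simp
  have hmul' : ∀ g h v, σ (g * h) v = σ g (σ h v) := fun g h v => by simp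
  by_cases hb : ∃ b, b ∉ Subgroup.zpowers a
  swap
  · push Not at hb
    refine ⟨⟨X, fun g => LinearMap.ext fun v => hX g (hb g) v⟩, fun h => hX0 ?_⟩
    exact congrArg Representation.IntertwiningMap.toLinearMap h
  obtain ⟨b, hb⟩ := hb
  have hb' : b⁻¹ ∉ Subgroup.zpowers a := fun h => hb (inv_mem_iff.1 h)
  let Φ : (V →ₗ[K] W) → (V →ₗ[K] W) := fun X => X + σ b⁻¹ ∘ₗ X ∘ₗ ρ b
  have hΦ : ∀ X v, Φ X v = X v + σ b⁻¹ (X (ρ b v)) := fun X v => rfl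
  have key : ∀ X : V →ₗ[K] W, (∀ x ∈ Subgroup.zpowers a, ∀ v, X (ρ x v) = σ x (X v)) →
      ∀ g v, Φ X (ρ g v) = σ g (Φ X v) := by
    intro X hX g v
    rw [hΦ, hΦ, map_add]
    by_cases hg : g ∈ Subgroup.zpowers a
    · congr 1
      · exact hX g hg v
      · rw [← hmul, show b * g = (b * g * b⁻¹) * b by group, hmul, hX _ (ha.conj_mem g hg b),
          ← hmul', ← hmul', show b⁻¹ * (b * g * b⁻¹) = g * b⁻¹ by group]
    · rw [add_comm]
      congr 1
      · rw [← hmul, hX _ (hind b g hb hg), ← hmul', inv_mul_cancel_left]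
      · rw [← hmul', ← hX _ (hind g b⁻¹ hg hb'), ← hmul, inv_mul_cancel_right]
  by_contra! hcon
  have hzero : ∀ X : V →ₗ[K] W, (∀ x ∈ Subgroup.zpowers a, ∀ v, X (ρ x v) = σ x (X v)) →
      ∀ v, Φ X v = 0 := by
    intro X hX v
    have := hcon ⟨Φ X, fun g => LinearMap.ext fun v => key X hX g v⟩
    exact congrArg (fun Y : ρ.IntertwiningMap σ => Y v) this
  have hXa : ∀ x ∈ Subgroup.zpowers a, ∀ v, (X ∘ₗ ρ a) (ρ x v) = σ x ((X ∘ₗ ρ a) v) := by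
    intro x hx v
    rw [LinearMap.comp_apply, LinearMap.comp_apply, ← hX x hx, ← hmul, ← hmul,
      setLike_mul_comm (s := Subgroup.zpowers a) (Subgroup.mem_zpowers a) hx]
  set c := b⁻¹ * a * b with hcdef
  have hcA : c ∈ Subgroup.zpowers a := by
    simpa using ha.conj_mem a (Subgroup.mem_zpowers a) b⁻¹
  have hca : c⁻¹ * a ≠ 1 := fun h => hb (hc b (by
    have h1 : c = a := inv_mul_eq_one.1 h
    rw [commute_iff_eq]
    calc b * a = b * c := by rw [h1]
      _ = a * b := by rw [hcdef]; group))
  have hXac : ∀ v, X ((ρ a - ρ c) v) = 0 := by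
    intro v
    have h1 := hzero X hX (ρ c v)
    have h2 := hzero _ hXa v
    rw [hΦ, ← hmul, show b * c = a * b by rw [hcdef]; group, hmul a b] at h1
    rw [hΦ, LinearMap.comp_apply, LinearMap.comp_apply] at h2
    rw [LinearMap.sub_apply, map_sub, sub_eq_zero]
    exact (add_right_cancel (h1.trans h2.symm)).symm
  have hinj : Function.Injective (ρ a - ρ c) := by
    rw [injective_iff_map_eq_zero]
    intro v hv
    rw [LinearMap.sub_apply, sub_eq_zero] at hv
    refine hρ.eq_zero_of_apply_eq hρ' (normal_zpowers_of_mem ha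
      (mul_mem (inv_mem hcA) (Subgroup.mem_zpowers a))) hca ?_
    rw [hmul, hv, ← hmul, inv_mul_cancel, map_one, Module.End.one_apply]
  refine hX0 (LinearMap.ext fun v => ?_)
  obtain ⟨u, rfl⟩ := LinearMap.surjective_of_injective hinj v
  exact hXac u

/-- Any two faithful irreducible representations of an ANC group differ by an automorphism of the
group. -/
lemma IsANCGroup.exists_mulEquiv_linearEquiv (hG : IsANCGroup G) {ρ : Representation K G V}
    {σ : Representation K G W}
    (hρ : ρ.IsIrreducible) (hρ' : Function.Injective ρ) (hσ : σ.IsIrreducible)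
    (hσ' : Function.Injective σ) :
    ∃ (α : G ≃* G) (θ : V ≃ₗ[K] W), ∀ g v, θ (ρ g v) = σ (α g) (θ v) := by
  have := hG.1
  obtain ⟨a, ha, hc⟩ := hG.exists_generator
  have hind : ∀ g h, g ∉ Subgroup.zpowers a → h ∉ Subgroup.zpowers a →
    g * h ∈ Subgroup.zpowers a := fun g h hg hh => hG.mul_mem_zpowers ha hc hg hh
  obtain ⟨k, X, hodd, hk, hX0, hX⟩ := hρ.exists_linearMap_comp_eq_comp_pow hρ' hσ hσ' ha
  obtain ⟨α, hα⟩ := exists_mulEquiv_eq_zpow ha hind (k := k) (by exact_mod_cast hodd)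
    (Nat.isCoprime_iff_coprime.2 hk)
  let τ : Representation K G W := σ.comp α.toMonoidHom
  have hτ : ∀ g, τ g = σ (α g) := fun g => rfl
  have hτ' : τ.IsIrreducible :=
    hσ.of_equiv (LinearEquiv.refl K W) α.symm fun g v => by simp [hτ]
  have hXa : ∀ x ∈ Subgroup.zpowers a, ∀ v, X (ρ x v) = τ x (X v) := by
    intro x hx
    obtain ⟨i, rfl⟩ := (mem_powers_iff_mem_zpowers).2 hx
    induction i with
    | zero => simp
    | succ i ih =>
      intro v
      have h1 := LinearMap.congr_fun hX v
      simp only [LinearMap.comp_apply] at h1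
      have h2 : τ a = σ (a ^ k) := by
        rw [hτ, hα a (Subgroup.mem_zpowers a), zpow_natCast]
      simp only at ih ⊢
      rw [pow_succ, map_mul, map_mul, Module.End.mul_apply, Module.End.mul_apply,
        ih (Subgroup.npow_mem_zpowers a i), h1, h2]
  obtain ⟨e⟩ := hρ.nonempty_equiv_of_comp_eq_comp hρ' hτ' ha hc hind hX0 hXa
  exact ⟨α, e.toLinearEquiv, fun g v =>
    Representation.IntertwiningMap.isIntertwining _ _ e.toIntertwiningMap g v⟩

end

/-! ### Existence -/

section

variable {G K : Type*} [Group G] [Field K] {a : G}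

/-- For a self-centralizing normal subgroup `⟨a⟩` of order `n`, the representation induced from the
character `a ↦ ζ` of `⟨a⟩`, with `ζ` a primitive `n`-th root of unity in a finite extension `L` of
`K`, has an irreducible constituent over `K`, and `G` acts faithfully on every nonzero invariant
subspace. The induced representation is realized on the functions `f : G → L` with
`f (a * x) = ζ * f x`. -/
lemma exists_faithful_isIrreducible [Finite G] [CharZero K] (ha : (Subgroup.zpowers a).Normal)
    (hc : ∀ g, Commute g a → g ∈ Subgroup.zpowers a) :
    ∃ (d : ℕ) (ρ : Representation K G (Fin d → K)), ρ.IsIrreducible ∧ Function.Injective ρ := by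
  classical
  have : NeZero (orderOf a) := ⟨(orderOf_pos a).ne'⟩
  let L := CyclotomicField (orderOf a) K
  have hζ : IsPrimitiveRoot (IsCyclotomicExtension.zeta (orderOf a) K L) (orderOf a) :=
    IsCyclotomicExtension.zeta_spec (orderOf a) K L
  set ζ := IsCyclotomicExtension.zeta (orderOf a) K L
  have : FiniteDimensional K L := IsCyclotomicExtension.finiteDimensional {orderOf a} K L
  let R : Representation K G (G → L) :=
    { toFun := fun g => LinearMap.funLeft K L (fun x => x * g)
      map_one' := by ext; simp
      map_mul' := fun g h => by ext; simp [mul_assoc] }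
  have hR : ∀ g f x, R g f x = f (x * g) := fun g f x => rfl
  let M : Submodule K (G → L) :=
    { carrier := {f | ∀ x, f (a * x) = ζ * f x}
      zero_mem' := by intro x; simp
      add_mem' := fun {f g} hf hg x => by simp [hf x, hg x, mul_add]
      smul_mem' := fun c f hf x => by simp [hf x] }
  have hM : ∀ f, f ∈ M ↔ ∀ x, f (a * x) = ζ * f x := fun f => Iff.rfl
  have hMpow : ∀ f ∈ M, ∀ (i : ℕ) x, f (a ^ i * x) = ζ ^ i * f x := by
    intro f hf i
    induction i with
    | zero => simp
    | succ i ih => intro x; rw [pow_succ', mul_assoc, (hM f).1 hf, ih, pow_succ', mul_assoc]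
  have hMR : ∀ g, ∀ f ∈ M, R g f ∈ M := fun g f hf x => by rw [hR, hR, mul_assoc, (hM f).1 hf]
  have hM0 : M ≠ ⊥ := by
    have hlog : ∀ x : G, ∃ i : ℤ, x ∈ Subgroup.zpowers a → a ^ i = x := by
      intro x
      by_cases hx : x ∈ Subgroup.zpowers a
      · exact (Subgroup.mem_zpowers_iff.1 hx).imp fun i hi _ => hi
      · exact ⟨0, fun h => absurd h hx⟩
    choose i hi using hlog
    let f : G → L := fun x => if x ∈ Subgroup.zpowers a then ζ ^ i x else 0
    have hf : f ∈ M := by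
      intro x
      by_cases hx : x ∈ Subgroup.zpowers a
      · have hax := mul_mem (Subgroup.mem_zpowers a) hx
        have h1 : a ^ (i (a * x) - (1 + i x)) = 1 := by
          rw [zpow_sub, zpow_add, zpow_one, hi x hx, hi _ hax, mul_inv_cancel]
        have h2 := (hζ.zpow_eq_one_iff_dvd _).2 (orderOf_dvd_iff_zpow_eq_one.2 h1)
        have h0 : ζ ≠ 0 := hζ.ne_zero (orderOf_pos a).ne'
        simp only [f, if_pos hx, if_pos hax]
        rw [zpow_sub₀ h0, div_eq_one_iff_eq (zpow_ne_zero _ h0)] at h2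
        rw [h2, zpow_add₀ h0, zpow_one]
      · have hax : a * x ∉ Subgroup.zpowers a := by
          rwa [Subgroup.mul_mem_cancel_left _ (Subgroup.mem_zpowers a)]
        simp [f, hx, hax]
    intro h0
    rw [h0, Submodule.mem_bot] at hf
    have := congrFun hf 1
    simp only [f, one_mem, if_true, Pi.zero_apply] at this
    exact zpow_ne_zero _ (hζ.ne_zero (orderOf_pos a).ne') this
  obtain ⟨p, ⟨hpM, hpR, hp0⟩, hmin⟩ := IsArtinian.set_has_minimal
    {p : Submodule K (G → L) | p ≤ M ∧ (∀ g, ∀ f ∈ p, R g f ∈ p) ∧ p ≠ ⊥} ⟨M, le_rfl, hMR, hM0⟩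
  let S : Subrepresentation R := ⟨p, fun g f hf => hpR g f hf⟩
  let ρ : Representation K G p := S.toRepresentation
  have hρ : ∀ g (f : p), (ρ g f : G → L) = R g f := fun g f => rfl
  have hirr : ρ.IsIrreducible := by
    rw [Representation.isIrreducible_iff_forall_submodule]
    refine ⟨Submodule.nontrivial_iff_ne_bot.2 hp0, fun q hq => ?_⟩
    by_contra! hcon
    refine hmin (q.map p.subtype) ⟨(Submodule.map_subtype_le p q).trans hpM, ?_, ?_⟩ ?_
    · rintro g _ ⟨f, hf, rfl⟩
      exact ⟨ρ g f, hq g f hf, hρ g f⟩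
    · exact fun h => hcon.1 (Submodule.map_injective_of_injective p.injective_subtype
        (h.trans (Submodule.map_bot _).symm))
    · refine lt_of_le_of_ne (Submodule.map_subtype_le p q) fun h => hcon.2 ?_
      rw [eq_top_iff]
      intro f _
      obtain ⟨f', hf', hff⟩ := h.ge f.2
      rwa [← Subtype.ext hff]
  have hker : ∀ x ∈ Subgroup.zpowers a, ρ x = 1 → x = 1 := by
    intro x hx h
    obtain ⟨f, hf, hf0⟩ := Submodule.exists_mem_ne_zero_of_ne_bot hp0
    obtain ⟨y, hy⟩ := Function.ne_iff.1 hf0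
    have h1 : f (y * x) = f y := by
      rw [← hR x f y, ← hρ x ⟨f, hf⟩, h]; rfl
    obtain ⟨j, hj⟩ := mem_powers_iff_mem_zpowers.2 (ha.conj_mem x hx y)
    have hj' : y * x = a ^ j * y := by
      simp only at hj; rw [hj]; group
    rw [hj', hMpow f (hpM hf)] at h1
    have h2 := orderOf_dvd_iff_pow_eq_one.1 (hζ.dvd_of_pow_eq_one j (mul_right_cancel₀ hy
      (h1.trans (one_mul _).symm)))
    simp only [h2] at hj
    exact conj_eq_one_iff.1 hj.symm
  have hinj : Function.Injective ρ := by
    have key : ∀ g, ρ g = 1 → g = 1 := by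
      intro g hg
      have hgi : ρ g⁻¹ = 1 := by
        have h := map_mul ρ g⁻¹ g
        rw [inv_mul_cancel, map_one, hg, mul_one] at h
        exact h.symm
      -- The kernel meets the normal subgroup `⟨a⟩` trivially, so it centralizes `⟨a⟩`.
      have hcm : ρ (g * a * g⁻¹ * a⁻¹) = 1 := by
        rw [map_mul, map_mul, map_mul, hg, hgi, one_mul, mul_one, ← map_mul, mul_inv_cancel,
          map_one]
      have h1 := hker _ (mul_mem (ha.conj_mem a (Subgroup.mem_zpowers a) g)
        (inv_mem (Subgroup.mem_zpowers a))) hcm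
      rw [mul_inv_eq_one, mul_inv_eq_iff_eq_mul] at h1
      exact hker g (hc g h1) hg
    intro g h hgh
    rw [← mul_inv_eq_one]
    refine key _ ?_
    rw [map_mul, hgh, ← map_mul, mul_inv_cancel, map_one]
  let e := (Module.finBasis K p).equivFun
  let σ : Representation K G (Fin (Module.finrank K p) → K) :=
    (e.conjRingEquiv : Module.End K p →* _).comp ρ
  have hσ : ∀ g v, e (ρ g v) = σ g (e v) := fun g v => by
    simp [σ, LinearEquiv.conjRingEquiv]
  refine ⟨_, σ, hirr.of_equiv e id hσ, fun g h hgh => hinj (LinearMap.ext fun v => ?_)⟩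
  apply e.injective
  rw [hσ, hσ, hgh]

end

/-! ### Linear groups -/

section

variable {G K V W : Type*} [Group G] [Field K] [AddCommGroup V] [Module K V]
  [AddCommGroup W] [Module K W]

lemma naturalRepresentation_injective (Γ : Subgroup (LinearMap.GeneralLinearGroup K V)) :
    Function.Injective (naturalRepresentation Γ) := fun _ _ h =>
  Subtype.ext (Units.ext h)

/-- A faithful irreducible representation has an irreducible linear group as its image. -/
lemma Representation.IsIrreducible.exists_isIrreducibleLinearGroup {ρ : Representation K G V}
    (hρ : ρ.IsIrreducible) (hinj : Function.Injective ρ) :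
    ∃ Γ : Subgroup (LinearMap.GeneralLinearGroup K V),
      IsIrreducibleLinearGroup Γ ∧ Nonempty (G ≃* Γ) := by
  have hu : Function.Injective (MonoidHom.toHomUnits ρ) := fun g h hgh =>
    hinj (congrArg Units.val hgh)
  let e := MonoidHom.ofInjective hu
  exact ⟨(MonoidHom.toHomUnits ρ).range, hρ.of_equiv (LinearEquiv.refl K V) e fun g v => rfl, ⟨e⟩⟩

lemma IsANCGroup.areSimilarLinearGroups (hG : IsANCGroup G)
    {Γ : Subgroup (LinearMap.GeneralLinearGroup K V)}
    {Δ : Subgroup (LinearMap.GeneralLinearGroup K W)} (hΓ : IsIrreducibleLinearGroup Γ)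
    (hΔ : IsIrreducibleLinearGroup Δ) (e : G ≃* Γ) (f : G ≃* Δ) : AreSimilarLinearGroups Γ Δ := by
  obtain ⟨α, θ, hθ⟩ := hG.exists_mulEquiv_linearEquiv
    (ρ := (naturalRepresentation Γ).comp e.toMonoidHom)
    (σ := (naturalRepresentation Δ).comp f.toMonoidHom)
    (hΓ.of_equiv (LinearEquiv.refl K V) e.symm fun g v => by simp)
    ((naturalRepresentation_injective Γ).comp e.injective)
    (hΔ.of_equiv (LinearEquiv.refl K W) f.symm fun g v => by simp)
    ((naturalRepresentation_injective Δ).comp f.injective)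
  have key : ∀ g, LinearMap.GeneralLinearGroup.congrLinearEquiv θ (e g) = f (α g) := by
    intro g
    refine Units.ext (LinearMap.ext fun w => ?_)
    have := hθ g (θ.symm w)
    rw [θ.apply_symm_apply] at this
    exact this
  refine ⟨θ, Subgroup.ext fun δ => ⟨?_, fun hδ => ?_⟩⟩
  · rintro ⟨γ, hγ, rfl⟩
    have := key (e.symm ⟨γ, hγ⟩)
    rw [e.apply_symm_apply] at this
    change LinearMap.GeneralLinearGroup.congrLinearEquiv θ γ ∈ Δ
    rw [this]
    exact (f _).2
  · refine ⟨e (α.symm (f.symm ⟨δ, hδ⟩)), (e _).2, ?_⟩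
    change LinearMap.GeneralLinearGroup.congrLinearEquiv θ _ = δ
    rw [key, α.apply_symm_apply, f.apply_symm_apply]

end

/-! ### Inequivalent faithful irreducible representations -/

section

lemma IsCyclic.isANCGroup {G : Type*} [CommGroup G] [Finite G] [IsCyclic G] : IsANCGroup G :=
  ⟨inferInstance, inferInstance, fun _ _ _ => inferInstance⟩

lemma Representation.isIrreducible_of_finrank_eq_one {G K V : Type*} [Group G] [Field K]
    [AddCommGroup V] [Module K V] (ρ : Representation K G V) (h : Module.finrank K V = 1) :
    ρ.IsIrreducible := by
  rw [Representation.isIrreducible_iff_forall_submodule]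
  have hs : IsSimpleModule K V := isSimpleModule_iff_finrank_eq_one.2 h
  exact ⟨hs.nontrivial, fun p _ => eq_bot_or_eq_top p⟩

/-- The linear character `χ` as a representation on `K ^ 1`. -/
noncomputable def scalarRepresentation {G K : Type*} [Group G] [Field K] (χ : G →* K) :
    Representation K G (Fin 1 → K) :=
  ((algebraMap K (Module.End K (Fin 1 → K))) : K →* _).comp χ

lemma scalarRepresentation_apply {G K : Type*} [Group G] [Field K] (χ : G →* K) (g : G)
    (v : Fin 1 → K) : scalarRepresentation χ g v = χ g • v := rfl

lemma scalarRepresentation_injective {G K : Type*} [Group G] [Field K] {χ : G →* K}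
    (h : Function.Injective χ) : Function.Injective (scalarRepresentation χ) := fun x y hxy =>
  h (by simpa [scalarRepresentation_apply] using congrFun (LinearMap.congr_fun hxy 1) 0)

end

theorem theorem3p1 :
    (∀ (G : Type*) [Group G] (K : Type*) [Field K] [CharZero K], IsANCGroup G →
      ∃ (d : ℕ) (Γ : Subgroup (LinearMap.GeneralLinearGroup K (Fin d → K))),
        IsIrreducibleLinearGroup Γ ∧ Nonempty (G ≃* Γ) ∧
        ∀ (V : Type*) [AddCommGroup V] [Module K V]
          (Δ : Subgroup (LinearMap.GeneralLinearGroup K V)),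
          IsIrreducibleLinearGroup Δ → Nonempty (G ≃* Δ) → AreSimilarLinearGroups Γ Δ) ∧
    (∃ (G : Type) (_ : Group G) (K : Type) (_ : Field K) (_ : CharZero K),
      IsANCGroup G ∧
      ∃ (d : ℕ) (ρ σ : Representation K G (Fin d → K)),
        Function.Injective ρ ∧ Function.Injective σ ∧
        ρ.IsIrreducible ∧ σ.IsIrreducible ∧ IsEmpty (ρ.Equiv σ)) := by
  refine ⟨fun G _ K _ _ hG => ?_, ?_⟩
  · have := hG.1
    obtain ⟨a, ha, hc⟩ := hG.exists_generator
    obtain ⟨d, ρ, hρ, hinj⟩ := exists_faithful_isIrreducible (K := K) ha hc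
    obtain ⟨Γ, hΓ, ⟨e⟩⟩ := hρ.exists_isIrreducibleLinearGroup hinj
    exact ⟨d, Γ, hΓ, ⟨e⟩, fun V _ _ Δ hΔ ⟨f⟩ => hG.areSimilarLinearGroups hΓ hΔ e f⟩
  · let χ : rootsOfUnity 4 ℂ →* ℂ := (Units.coeHom ℂ).comp (rootsOfUnity 4 ℂ).subtype
    have hχ : Function.Injective χ := Units.val_injective.comp Subtype.val_injective
    have hχ' : Function.Injective (χ.comp (invMonoidHom : rootsOfUnity 4 ℂ →* _)) :=
      hχ.comp inv_injective
    refine ⟨rootsOfUnity 4 ℂ, inferInstance, ℂ, inferInstance, inferInstance,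
      IsCyclic.isANCGroup, 1, scalarRepresentation χ, scalarRepresentation (χ.comp invMonoidHom),
      scalarRepresentation_injective hχ, scalarRepresentation_injective hχ',
      Representation.isIrreducible_of_finrank_eq_one _ (by simp),
      Representation.isIrreducible_of_finrank_eq_one _ (by simp), ⟨fun e => ?_⟩⟩
    -- An equivalence forces `z = z⁻¹` for all fourth roots of unity `z`.
    let z : rootsOfUnity 4 ℂ := ⟨Units.mk0 Complex.I Complex.I_ne_zero, by
      rw [mem_rootsOfUnity]; ext; simp⟩
    have h1 : e.toLinearEquiv (Complex.I • 1) = Complex.I⁻¹ • e.toLinearEquiv 1 := by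
      have := Representation.IntertwiningMap.isIntertwining _ _ e.toIntertwiningMap z 1
      rw [scalarRepresentation_apply, scalarRepresentation_apply] at this
      exact this
    rw [map_smul, Complex.inv_I, neg_smul, eq_neg_iff_add_eq_zero, ← add_smul, smul_eq_zero,
      EmbeddingLike.map_eq_zero_iff] at h1
    simp at h1
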